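/- Let $\kappa\le\lambda$ be cardinals with $\kappa$ regular and uncountable. For a set $X$ let $P_\kappa X=\{x\subseteq X : |x|<\kappa\}$. A set $C\subseteq P_\kappa X$ is club if every $x\in P_\kappa X$ is included in some $c\in C$ and $C$ is closed under unions of nonempty $\subseteq$-chains of length less than $\kappa$; a set $S\subseteq P_\kappa X$ is stationary if it meets every club $C\subseteq P_\kappa X$. For a cardinal $\theta$ let $H_\theta$ be the set of all sets whose transitive closure has cardinality less than $\theta$. A $P_\kappa\lambda$-list is a sequence $D=\langle d_a : a\in P_\kappa\lambda\rangle$ with $d_a\subseteq a$ for all $a$. It is * thin if there is a club $C\subseteq P_\kappa\lambda$ such that $|\{d_a\cap c : c\subseteq a\in P_\kappa\lambda\}|<\kappa$ for every $c\in C$; * slender if there is a cardinal $\theta_0$ such that for every cardinal $\theta\ge\theta_0$ there is a club $C\subseteq P_\kappa H_\theta$ with $d_{M\cap\lambda}\cap b\in M$ for all $M\in C$ and all $b\in M\cap P_{\omega_1}\lambda$; * $A$-effable, for $A\subseteq P_\kappa\lambda$, if for every $S\subseteq A$ that is stationary in $P_\kappa\lambda$ there are $a,b\in S$ with $a\subseteq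 b$ and $d_a\ne d_b\cap a$. Let $I_{\mathrm{IT}}[\kappa,\lambda]$ (respectively $I_{\mathrm{IS}}[\kappa,\lambda]$) be the set of all $A\subseteq P_\kappa\lambda$ for which there is a thin (respectively slender) $A$-effable $P_\kappa\lambda$-list. Then $I_{\mathrm{IT}}[\kappa,\lambda]$ and $I_{\mathrm{IS}}[\kappa,\lambda]$ are (possibly improper) normal ideals on $P_\kappa\lambda$. That is, each of them, call it $I$, contains $\emptyset$, is closed under subsets and under unions of fewer than $\kappa$ members, contains $\{a\in P_\kappa\lambda : \gamma\notin a\}$ for every $\gamma<\lambda$, and satisfies: if $D\subseteq P_\kappa\lambda$ and $g:D\to\lambda$ is regressive, i.e. $g(a)\in a$ for all $a\in D$, and $\{a\in D : g(a)=\gamma\}\in I$ for every $\gamma<\lambda$, then $D\in I$. -/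

import Mathlib

open Cardinal

universe u

/-! Sets are elements of `ZFSet.{u}`; a cardinal `lam` is identified, as a set, with the von Neumann
ordinal `lam.ord.toZFSet`. Families of sets (clubs, stationary sets, members of an ideal) are
`Set ZFSet.{u}`. -/

namespace TwoCardinal

/-- `P_κ X`: the subsets of `X` of cardinality less than `κ`. -/
def Pk (κ : Cardinal.{u}) (X : ZFSet.{u}) : Set ZFSet.{u} :=
  {x | x ⊆ X ∧ x.card < κ}

/-- The cardinal `lam` as a set: the set of all von Neumann ordinals below it. -/
noncomputable def cardSet (lam : Cardinal.{u}) : ZFSet.{u} :=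
  lam.ord.toZFSet

/-- `H_θ`: the sets whose transitive closure has cardinality less than `θ`
(equivalently, the sets included in a transitive set of cardinality less than `θ`). Such sets have
rank below `θ`, so that separation from `V_θ` loses nothing: see `mem_H`. -/
noncomputable def H (θ : Cardinal.{u}) : ZFSet.{u} :=
  ZFSet.sep (fun x => ∃ t : ZFSet.{u}, t.IsTransitive ∧ x ⊆ t ∧ t.card < θ)
    (ZFSet.vonNeumann θ.ord)

theorem exists_rank_eq {t : ZFSet.{u}} (ht : t.IsTransitive) {α : Ordinal.{u}}
    (hα : α < t.rank) : ∃ y ∈ t, y.rank = α := by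
  by_contra hne
  push Not at hne
  have key : ∀ y : ZFSet.{u}, y ∈ t → y.rank < α := by
    intro y
    induction y using ZFSet.inductionOn with
    | _ y ih =>
      intro hy
      have hle : y.rank ≤ α := ZFSet.rank_le_iff.2 fun {z} hz => ih z hz (ht y hy hz)
      exact lt_of_le_of_ne hle (hne y hy)
  exact absurd (ZFSet.rank_le_iff.2 fun {z} hz => key z hz) (not_le.2 hα)

theorem card_rank_le {t : ZFSet.{u}} (ht : t.IsTransitive) : t.rank.card ≤ t.card := by
  rw [← Cardinal.lift_le.{u + 1}, ← ZFSet.cardinalMk_coe_sort, ← Cardinal.mk_Iio_ordinal]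
  choose f hf hr using fun α : Set.Iio t.rank => exists_rank_eq ht α.2
  refine Cardinal.mk_le_of_injective (f := fun α => (⟨f α, hf α⟩ : t)) fun α β h => ?_
  have h1 : f α = f β := congrArg Subtype.val h
  exact Subtype.ext (by rw [← hr α, ← hr β, h1])

theorem mem_H {θ : Cardinal.{u}} {x : ZFSet.{u}} :
    x ∈ H θ ↔ ∃ t : ZFSet.{u}, t.IsTransitive ∧ x ⊆ t ∧ t.card < θ := by
  rw [H, ZFSet.mem_sep, and_iff_right_iff_imp]
  rintro ⟨t, ht, hx, hc⟩
  rw [ZFSet.mem_vonNeumann]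
  exact (ZFSet.rank_mono hx).trans_lt (Cardinal.lt_ord.2 ((card_rank_le ht).trans_lt hc))

/-- `C` is club in `P_κ X`: it is cofinal, and closed under unions of nonempty `⊆`-chains of
length less than `κ`. -/
structure IsClubIn (κ : Cardinal.{u}) (X : ZFSet.{u}) (C : Set ZFSet.{u}) : Prop where
  subset : C ⊆ Pk κ X
  cofinal : ∀ x ∈ Pk κ X, ∃ c ∈ C, x ⊆ c
  closed : ∀ K : ZFSet.{u}, K.Nonempty → K.card < κ → (∀ x ∈ K, x ∈ C) →
    (∀ x ∈ K, ∀ y ∈ K, x ⊆ y ∨ y ⊆ x) → ZFSet.sUnion K ∈ C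

/-- `S` is stationary in `P_κ X`. -/
def IsStationaryIn (κ : Cardinal.{u}) (X : ZFSet.{u}) (S : Set ZFSet.{u}) : Prop :=
  S ⊆ Pk κ X ∧ ∀ C, IsClubIn κ X C → (S ∩ C).Nonempty

/-- `d` (only its values on `P_κ lam` matter) is a `P_κ lam`-list. -/
def IsList (κ lam : Cardinal.{u}) (d : ZFSet.{u} → ZFSet.{u}) : Prop :=
  ∀ a ∈ Pk κ (cardSet lam), d a ⊆ a

/-- Thin: there is a club `C` with `|{d_a ∩ c | c ⊆ a ∈ P_κ lam}| < κ` for all `c ∈ C`. -/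
def IsThin (κ lam : Cardinal.{u}) (d : ZFSet.{u} → ZFSet.{u}) : Prop :=
  ∃ C, IsClubIn κ (cardSet lam) C ∧ ∀ c ∈ C,
    #{x : ZFSet.{u} | ∃ a ∈ Pk κ (cardSet lam), c ⊆ a ∧ x = d a ∩ c} < Cardinal.lift.{u + 1} κ

/-- Slender: for every sufficiently large cardinal `θ` there is a club `C` in `P_κ H_θ` such that
`d_{M ∩ lam} ∩ b ∈ M` for all `M ∈ C` and all `b ∈ M ∩ P_{ω₁} lam`. -/
def IsSlender (κ lam : Cardinal.{u}) (d : ZFSet.{u} → ZFSet.{u}) : Prop :=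
  ∃ θ₀ : Cardinal.{u}, ∀ θ : Cardinal.{u}, θ₀ ≤ θ →
    ∃ C, IsClubIn κ (H θ) C ∧
      ∀ M ∈ C, ∀ b ∈ M, b ∈ Pk ℵ₁ (cardSet lam) → d (M ∩ cardSet lam) ∩ b ∈ M

/-- `d` is `A`-effable. -/
def IsEffableOn (κ lam : Cardinal.{u}) (A : Set ZFSet.{u}) (d : ZFSet.{u} → ZFSet.{u}) : Prop :=
  ∀ S ⊆ A, IsStationaryIn κ (cardSet lam) S → ∃ a ∈ S, ∃ b ∈ S, a ⊆ b ∧ d a ≠ d b ∩ a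

/-- `I_IT[κ, lam]`: the sets `A ⊆ P_κ lam` carrying a thin `A`-effable list. -/
def I_IT (κ lam : Cardinal.{u}) : Set (Set ZFSet.{u}) :=
  {A | A ⊆ Pk κ (cardSet lam) ∧ ∃ d, IsList κ lam d ∧ IsThin κ lam d ∧ IsEffableOn κ lam A d}

/-- `I_IS[κ, lam]`: the sets `A ⊆ P_κ lam` carrying a slender `A`-effable list. -/
def I_IS (κ lam : Cardinal.{u}) : Set (Set ZFSet.{u}) :=
  {A | A ⊆ Pk κ (cardSet lam) ∧ ∃ d, IsList κ lam d ∧ IsSlender κ lam d ∧ IsEffableOn κ lam A d}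

/-- `I` is a (possibly improper) normal ideal on `P_κ X`: a `κ`-complete fine ideal such that a set
`D` belongs to `I` as soon as all fibres of some regressive `g : D → X` do. -/
structure IsNormalIdeal (κ : Cardinal.{u}) (X : ZFSet.{u}) (I : Set (Set ZFSet.{u})) : Prop where
  subset : ∀ A ∈ I, A ⊆ Pk κ X
  empty : ∅ ∈ I
  mono : ∀ A ∈ I, ∀ B ⊆ A, B ∈ I
  union : ∀ A ∈ I, ∀ B ∈ I, A ∪ B ∈ I
  complete : ∀ (ι : Type u) (A : ι → Set ZFSet.{u}), #ι < κ → (∀ i, A i ∈ I) → (⋃ i, A i) ∈ I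
  fine : ∀ γ ∈ X, {a ∈ Pk κ X | γ ∉ a} ∈ I
  normal : ∀ D ⊆ Pk κ X, ∀ g : ZFSet.{u} → ZFSet.{u}, (∀ a ∈ D, g a ∈ a) →
    (∀ γ ∈ X, {a ∈ D | g a = γ} ∈ I) → D ∈ I

end TwoCardinal

namespace TwoCardinal

/-! Normality is the heart; completeness follows from it, and fineness holds since nonstationary
sets carry an effable list vacuously. Given a regressive `g` on `D` and lists `d γ` effable on its
fibres, fix a pairing function `f` on `lam` and let the glued list code at `a` the set `d (g a) a`
as its image under `f (g a)`, cut down to `a`. By Fodor's lemma a stationary `S ⊆ D` has a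
stationary subset on which `g` is a constant `γ` and `a` is closed under `f`. There the code can be
decoded, so the disagreement supplied by `d γ` is one for the glued list (`isEffableOn_glue`).
Gluing preserves thinness and slenderness, by diagonal intersections of the given clubs
(`isThin_glue`, `isSlender_glue`). -/

variable {κ : Cardinal.{u}} {X : ZFSet.{u}}

/-! ### Clubs and stationary sets -/

theorem card_iUnion_lt (hκ : κ.IsRegular) {ι : Type u} {f : ι → ZFSet.{u}} (hι : #ι < κ)
    (hf : ∀ i, (f i).card < κ) : (ZFSet.iUnion f).card < κ := by
  have h := ZFSet.lift_card_iUnion_le_sum_card.{u, u} (f := f)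
  rw [Cardinal.lift_id] at h
  exact h.trans_lt (Cardinal.sum_lt_of_isRegular hκ hι hf)

theorem card_sUnion_lt (hκ : κ.IsRegular) {K : ZFSet.{u}} (hK : K.card < κ)
    (h : ∀ x ∈ K, x.card < κ) : (ZFSet.sUnion K).card < κ := by
  have h1 : ZFSet.sUnion K ⊆ ZFSet.iUnion fun i : Shrink.{u} K => ((equivShrink K).symm i : ZFSet) := by
    intro z hz
    obtain ⟨y, hy, hzy⟩ := ZFSet.mem_sUnion.1 hz
    exact ZFSet.mem_iUnion.2 ⟨equivShrink K ⟨y, hy⟩, by simpa using hzy⟩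
  exact (ZFSet.card_mono h1).trans_lt
    (card_iUnion_lt hκ hK fun i => h _ ((equivShrink K).symm i).2)

theorem isClubIn_Pk (hκ : κ.IsRegular) (X : ZFSet.{u}) : IsClubIn κ X (Pk κ X) where
  subset := subset_rfl
  cofinal x hx := ⟨x, hx, fun _ h => h⟩
  closed K _ hK hKC _ := by
    refine ⟨fun z hz => ?_, card_sUnion_lt hκ hK fun x hx => (hKC x hx).2⟩
    obtain ⟨y, hy, hzy⟩ := ZFSet.mem_sUnion.1 hz
    exact (hKC y hy).1 hzy

theorem union_mem_Pk (hκ : κ.IsRegular) {x y : ZFSet.{u}} (hx : x ∈ Pk κ X) (hy : y ∈ Pk κ X) :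
    x ∪ y ∈ Pk κ X := by
  refine ⟨fun z hz => ?_, ZFSet.card_union_le.trans_lt
    (Cardinal.add_lt_of_lt hκ.aleph0_le hx.2 hy.2)⟩
  rcases ZFSet.mem_union.1 hz with h | h
  · exact hx.1 h
  · exact hy.1 h

theorem isClubIn_superset (hκ : κ.IsRegular) {E : ZFSet.{u}} (hE : E ∈ Pk κ X) :
    IsClubIn κ X {a ∈ Pk κ X | E ⊆ a} where
  subset _ h := h.1
  cofinal x hx := ⟨x ∪ E, ⟨union_mem_Pk hκ hx hE, fun _ h => ZFSet.mem_union.2 (.inr h)⟩,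
    fun _ h => ZFSet.mem_union.2 (.inl h)⟩
  closed K hne hK hKC hch := by
    refine ⟨(isClubIn_Pk hκ X).closed K hne hK (fun x hx => (hKC x hx).1) hch, fun z hz => ?_⟩
    obtain ⟨k, hk⟩ := hne
    exact ZFSet.mem_sUnion.2 ⟨k, hk, (hKC k hk).2 hz⟩

theorem isClubIn_mem (hκ : κ.IsRegular) {γ : ZFSet.{u}} (hγ : γ ∈ X) :
    IsClubIn κ X {a ∈ Pk κ X | γ ∈ a} := by
  have hE : ({γ} : ZFSet.{u}) ∈ Pk κ X :=
    ⟨fun z hz => ZFSet.mem_singleton.1 hz ▸ hγ,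
      by simpa using Cardinal.one_lt_aleph0.trans_le hκ.aleph0_le⟩
  convert isClubIn_superset hκ hE using 4 with a
  exact ⟨fun h z hz => ZFSet.mem_singleton.1 hz ▸ h, fun h => h (ZFSet.mem_singleton.2 rfl)⟩

theorem subset_of_le_of_subset_succ {x : ℕ → ZFSet.{u}} (hx : ∀ n, x n ⊆ x (n + 1)) {m n : ℕ}
    (h : m ≤ n) : x m ⊆ x n :=
  monotone_nat_of_le_succ (f := x) hx h

theorem IsClubIn.iUnion_nat_mem {C : Set ZFSet.{u}} (hC : IsClubIn κ X C) (hκ : ℵ₀ < κ)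
    {c : ℕ → ZFSet.{u}} (hc : ∀ n, c n ∈ C) (hmono : ∀ n, c n ⊆ c (n + 1)) :
    ZFSet.iUnion c ∈ C := by
  refine hC.closed (ZFSet.range c) ⟨c 0, by simp⟩ ?_ ?_ ?_
  · have h := ZFSet.lift_card_range_le.{0, u} (f := c)
    rw [Cardinal.lift_uzero, Cardinal.mk_nat, Cardinal.lift_aleph0] at h
    exact h.trans_lt hκ
  · intro x hx
    obtain ⟨n, rfl⟩ := ZFSet.mem_range.1 hx
    exact hc n
  · intro x hx y hy
    obtain ⟨m, rfl⟩ := ZFSet.mem_range.1 hx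
    obtain ⟨n, rfl⟩ := ZFSet.mem_range.1 hy
    exact (le_total m n).imp (subset_of_le_of_subset_succ hmono)
      (subset_of_le_of_subset_succ hmono)

/-- The two interleaved chains have the same union. The offset `N` serves diagonal intersections,
where the club of `γ` matters only once `γ` has entered the sequence. -/
theorem IsClubIn.iUnion_nat_mem_of_interleaved {C : Set ZFSet.{u}} (hC : IsClubIn κ X C)
    (hκ : ℵ₀ < κ) {x c : ℕ → ZFSet.{u}} (hx : ∀ n, x n ⊆ x (n + 1)) (N : ℕ)
    (hc : ∀ n, N ≤ n → c n ∈ C ∧ x n ⊆ c n ∧ c n ⊆ x (n + 1)) : ZFSet.iUnion x ∈ C := by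
  have h : ZFSet.iUnion x = ZFSet.iUnion fun n => c (N + n) := by
    ext z
    simp only [ZFSet.mem_iUnion]
    constructor
    · rintro ⟨n, hn⟩
      exact ⟨n, (hc (N + n) (by lia)).2.1 (subset_of_le_of_subset_succ hx (by lia) hn)⟩
    · rintro ⟨n, hn⟩
      exact ⟨_, (hc (N + n) (by lia)).2.2 hn⟩
  rw [h]
  exact hC.iUnion_nat_mem hκ (fun n => (hc (N + n) (by lia)).1) fun n z hz =>
    (hc (N + n + 1) (by lia)).2.1 ((hc (N + n) (by lia)).2.2 hz)

theorem exists_closure_sequence (hκ : κ.IsRegular) {Φ : ZFSet.{u} → ZFSet.{u}}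
    (hΦ : ∀ x ∈ Pk κ X, Φ x ∈ Pk κ X) {x : ZFSet.{u}} (hx : x ∈ Pk κ X) :
    ∃ s : ℕ → ZFSet.{u}, s 0 = x ∧ (∀ n, s n ∈ Pk κ X) ∧ (∀ n, s n ⊆ s (n + 1)) ∧
      ∀ n, Φ (s n) ⊆ s (n + 1) := by
  refine ⟨fun n => Nat.rec x (fun _ y => y ∪ Φ y) n, rfl, fun n => ?_,
    fun n z hz => ZFSet.mem_union.2 (.inl hz), fun n z hz => ZFSet.mem_union.2 (.inr hz)⟩
  induction n with
  | zero => exact hx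
  | succ n ih => exact union_mem_Pk hκ ih (hΦ _ ih)

theorem IsClubIn.inter {C C' : Set ZFSet.{u}} (hC : IsClubIn κ X C) (hC' : IsClubIn κ X C')
    (hκ : κ.IsRegular) (hκ_unc : ℵ₀ < κ) : IsClubIn κ X (C ∩ C') where
  subset _ h := hC.subset h.1
  cofinal x hx := by
    choose! c hc hxc using hC.cofinal
    choose! c' hc' hxc' using hC'.cofinal
    obtain ⟨s, rfl, hs, hmono, hΦ⟩ := exists_closure_sequence hκ (Φ := fun x => c' (c x))
      (fun x hx => hC'.subset (hc' _ (hC.subset (hc x hx)))) hx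
    have h1 : ∀ n, c (s n) ∈ Pk κ X := fun n => hC.subset (hc _ (hs n))
    refine ⟨ZFSet.iUnion s, ⟨?_, ?_⟩, ZFSet.subset_iUnion s 0⟩
    · exact hC.iUnion_nat_mem_of_interleaved hκ_unc hmono (c := fun n => c (s n)) 0 fun n _ =>
        ⟨hc _ (hs n), hxc _ (hs n), fun z hz => hΦ n (hxc' _ (h1 n) hz)⟩
    · exact hC'.iUnion_nat_mem_of_interleaved hκ_unc hmono (c := fun n => c' (c (s n))) 0
        fun n _ => ⟨hc' _ (h1 n), fun z hz => hxc' _ (h1 n) (hxc _ (hs n) hz), hΦ n⟩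
  closed K hne hK hKC hch :=
    ⟨hC.closed K hne hK (fun x hx => (hKC x hx).1) hch,
      hC'.closed K hne hK (fun x hx => (hKC x hx).2) hch⟩

theorem isClubIn_diagonal (hκ : κ.IsRegular) (hκ_unc : ℵ₀ < κ) {C : ZFSet.{u} → Set ZFSet.{u}}
    (hC : ∀ γ ∈ X, IsClubIn κ X (C γ)) : IsClubIn κ X {a ∈ Pk κ X | ∀ γ ∈ a, a ∈ C γ} where
  subset _ h := h.1
  cofinal x hx := by
    choose! c hc hxc using fun γ (hγ : γ ∈ X) => (hC γ hγ).cofinal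
    obtain ⟨s, rfl, hs, hmono, hΦ⟩ := exists_closure_sequence hκ
      (Φ := fun x => ZFSet.iUnion fun i : Shrink.{u} x => c ((equivShrink x).symm i) x)
      (fun x hx => by
        have h : ∀ i : Shrink.{u} x, c ((equivShrink x).symm i) x ∈ Pk κ X := fun i =>
          have hi := hx.1 ((equivShrink x).symm i).2
          (hC _ hi).subset (hc _ hi x hx)
        refine ⟨fun z hz => ?_, card_iUnion_lt hκ hx.2 fun i => (h i).2⟩
        obtain ⟨i, hi⟩ := ZFSet.mem_iUnion.1 hz
        exact (h i).1 hi) hx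
    refine ⟨ZFSet.iUnion s, ⟨(isClubIn_Pk hκ X).iUnion_nat_mem hκ_unc hs hmono,
      fun γ hγ => ?_⟩, ZFSet.subset_iUnion s 0⟩
    obtain ⟨N, hN⟩ := ZFSet.mem_iUnion.1 hγ
    have hγX := (hs N).1 hN
    refine (hC γ hγX).iUnion_nat_mem_of_interleaved hκ_unc hmono (c := fun n => c γ (s n)) N
      fun n hn => ⟨hc γ hγX _ (hs n), hxc γ hγX _ (hs n), fun z hz => hΦ n ?_⟩
    exact ZFSet.mem_iUnion.2 ⟨equivShrink (s n)
      ⟨γ, subset_of_le_of_subset_succ hmono hn hN⟩, by simpa using hz⟩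
  closed K hne hK hKC hch := by
    refine ⟨(isClubIn_Pk hκ X).closed K hne hK (fun x hx => (hKC x hx).1) hch, fun γ hγ => ?_⟩
    obtain ⟨k, hk, hγk⟩ := ZFSet.mem_sUnion.1 hγ
    have hγX := (hKC k hk).1.1 hγk
    -- Only the members of `K` above `k` are known to contain `γ`; this tail of the chain has the
    -- same union.
    have hsub : ZFSet.sep (fun y => k ⊆ y) K ⊆ K := ZFSet.sep_subset
    have h : ZFSet.sUnion K = ZFSet.sUnion (ZFSet.sep (fun y => k ⊆ y) K) := by
      ext z
      simp only [ZFSet.mem_sUnion, ZFSet.mem_sep]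
      constructor
      · rintro ⟨y, hy, hz⟩
        rcases hch k hk y hy with h | h
        · exact ⟨y, ⟨hy, h⟩, hz⟩
        · exact ⟨k, ⟨hk, fun _ h => h⟩, h hz⟩
      · rintro ⟨y, ⟨hy, _⟩, hz⟩
        exact ⟨y, hy, hz⟩
    rw [h]
    refine (hC γ hγX).closed _ ⟨k, ZFSet.mem_sep.2 ⟨hk, fun _ h => h⟩⟩
      ((ZFSet.card_mono hsub).trans_lt hK) (fun x hx => ?_)
      fun x hx y hy => hch x (hsub hx) y (hsub hy)
    have hx' := ZFSet.mem_sep.1 hx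
    exact (hKC x hx'.1).2 γ (hx'.2 hγk)

theorem isClubIn_closed_unary (hκ : κ.IsRegular) (hκ_unc : ℵ₀ < κ) {F : ZFSet.{u} → ZFSet.{u}}
    (hF : ∀ x ∈ X, F x ∈ X) : IsClubIn κ X {a ∈ Pk κ X | ∀ x ∈ a, F x ∈ a} := by
  convert isClubIn_diagonal hκ hκ_unc fun x hx => isClubIn_mem hκ (hF x hx) using 3
  simp +contextual [and_congr_right_iff]

theorem isClubIn_closed_binary (hκ : κ.IsRegular) (hκ_unc : ℵ₀ < κ)
    {F : ZFSet.{u} → ZFSet.{u} → ZFSet.{u}} (hF : ∀ x ∈ X, ∀ y ∈ X, F x y ∈ X) :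
    IsClubIn κ X {a ∈ Pk κ X | ∀ x ∈ a, ∀ y ∈ a, F x y ∈ a} := by
  convert isClubIn_diagonal hκ hκ_unc fun x hx =>
    isClubIn_closed_unary hκ hκ_unc (hF x hx) using 3
  simp +contextual [and_congr_right_iff]

theorem IsStationaryIn.inter_club {S C : Set ZFSet.{u}} (hS : IsStationaryIn κ X S)
    (hC : IsClubIn κ X C) (hκ : κ.IsRegular) (hκ_unc : ℵ₀ < κ) : IsStationaryIn κ X (S ∩ C) :=
  ⟨fun _ h => hS.1 h.1, fun C' hC' => by
    obtain ⟨a, ha, haC, haC'⟩ := hS.2 _ (hC.inter hC' hκ hκ_unc)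
    exact ⟨a, ⟨ha, haC⟩, haC'⟩⟩

/-- Fodor's lemma on `P_κ X`. -/
theorem IsStationaryIn.exists_stationary_fiber {S : Set ZFSet.{u}} (hS : IsStationaryIn κ X S)
    (hκ : κ.IsRegular) (hκ_unc : ℵ₀ < κ) {g : ZFSet.{u} → ZFSet.{u}} (hg : ∀ a ∈ S, g a ∈ a) :
    ∃ γ ∈ X, IsStationaryIn κ X {a ∈ S | g a = γ} := by
  by_contra! hne
  have h : ∀ γ ∈ X, ∃ C, IsClubIn κ X C ∧ ¬({a ∈ S | g a = γ} ∩ C).Nonempty := by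
    intro γ hγ
    by_contra! h
    exact hne γ hγ ⟨fun a ha => hS.1 ha.1, fun C hC => h C hC⟩
  choose! C hC hdisj using h
  obtain ⟨a, ha, haP, haC⟩ := hS.2 _ (isClubIn_diagonal hκ hκ_unc hC)
  exact hdisj (g a) (haP.1 (hg a ha)) ⟨a, ⟨ha, rfl⟩, haC _ (hg a ha)⟩

/-! ### Pairing and glued lists -/

/-- `f` is a pairing function on `X` with projections `p` and `q`. -/
structure IsPairing (X : ZFSet.{u}) (f : ZFSet.{u} → ZFSet.{u} → ZFSet.{u})
    (p q : ZFSet.{u} → ZFSet.{u}) : Prop where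
  mem : ∀ x y, f x y ∈ X
  fst_mem : ∀ z, p z ∈ X
  snd_mem : ∀ z, q z ∈ X
  fst : ∀ x ∈ X, ∀ y ∈ X, p (f x y) = x
  snd : ∀ x ∈ X, ∀ y ∈ X, q (f x y) = y

theorem exists_isPairing (hX : ℵ₀ ≤ X.card) : ∃ f p q, IsPairing X f p q := by
  classical
  have hX' : ℵ₀ ≤ #X := by
    rw [ZFSet.cardinalMk_coe_sort, Cardinal.aleph0_le_lift]
    exact hX
  obtain ⟨e⟩ : Nonempty (X × X ≃ X) := by
    rw [← Cardinal.eq, Cardinal.mk_prod, Cardinal.lift_id, Cardinal.mul_eq_self hX']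
  obtain ⟨x₀⟩ : Nonempty X := Cardinal.mk_ne_zero_iff.1
    (Cardinal.aleph0_pos.trans_le hX').ne'
  -- The default `x₀` keeps all values in `X`, even for arguments outside it.
  let r : ZFSet.{u} → X := fun z => if h : z ∈ X then ⟨z, h⟩ else x₀
  have hr : ∀ z : X, r z = z := fun z => dif_pos z.2
  refine ⟨fun x y => e (r x, r y), fun z => (e.symm (r z)).1, fun z => (e.symm (r z)).2,
    fun x y => (e _).2, fun z => Subtype.property _, fun z => Subtype.property _, ?_, ?_⟩
  · intro x hx y hy
    simp only [hr, Equiv.symm_apply_apply]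
    exact congrArg Subtype.val (hr ⟨x, hx⟩)
  · intro x hx y hy
    simp only [hr, Equiv.symm_apply_apply]
    exact congrArg Subtype.val (hr ⟨y, hy⟩)

/-- The list glued, along a regressive function `g` on `D`, from the lists `d γ`. -/
noncomputable def glue (f : ZFSet.{u} → ZFSet.{u} → ZFSet.{u}) (D : Set ZFSet.{u})
    (g : ZFSet.{u} → ZFSet.{u}) (d : ZFSet.{u} → ZFSet.{u} → ZFSet.{u}) (a : ZFSet.{u}) :
    ZFSet.{u} :=
  ZFSet.sep (fun η => a ∈ D ∧ ∃ ξ ∈ d (g a) a, η = f (g a) ξ) a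

variable {lam : Cardinal.{u}} {f : ZFSet.{u} → ZFSet.{u} → ZFSet.{u}}
  {p q g : ZFSet.{u} → ZFSet.{u}} {D : Set ZFSet.{u}} {d : ZFSet.{u} → ZFSet.{u} → ZFSet.{u}}

theorem mem_glue {a η : ZFSet.{u}} :
    η ∈ glue f D g d a ↔ η ∈ a ∧ a ∈ D ∧ ∃ ξ ∈ d (g a) a, η = f (g a) ξ :=
  ZFSet.mem_sep

theorem isList_glue : IsList κ lam (glue f D g d) := fun _ _ => ZFSet.sep_subset

theorem isEffableOn_glue (hκ : κ.IsRegular) (hκ_unc : ℵ₀ < κ)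
    (hf : IsPairing (cardSet lam) f p q) (hg : ∀ a ∈ D, g a ∈ a)
    (hd : ∀ γ ∈ cardSet lam, IsList κ lam (d γ))
    (hE : ∀ γ ∈ cardSet lam, IsEffableOn κ lam {a ∈ D | g a = γ} (d γ)) :
    IsEffableOn κ lam D (glue f D g d) := by
  intro S hSD hS
  have hC := isClubIn_closed_binary hκ hκ_unc (X := cardSet lam) (F := f) fun x _ y _ => hf.mem x y
  obtain ⟨γ, hγ, hSγ⟩ := (hS.inter_club hC hκ hκ_unc).exists_stationary_fiber hκ hκ_unc
    fun a ha => hg a (hSD ha.1)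
  obtain ⟨a, ⟨⟨haS, haP, hac⟩, hga⟩, b, ⟨⟨hbS, hbP, hbc⟩, hgb⟩, hab, hne⟩ :=
    hE γ hγ _ (fun a ha => ⟨hSD ha.1.1, ha.2⟩) hSγ
  refine ⟨a, haS, b, hbS, hab, fun heq => hne ?_⟩
  have hγa : γ ∈ a := hga ▸ hg a (hSD haS)
  -- Decoding on `a`: closure of `a` under `f` ensures that no code of a `ξ ∈ a` is cut off, and the
  -- projection `q` recovers `ξ`.
  have mem_iff : ∀ e ∈ S, e ∈ Pk κ (cardSet lam) → g e = γ → a ⊆ e → ∀ ξ ∈ a,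
      (f γ ξ ∈ glue f D g d e ↔ ξ ∈ d γ e) := by
    intro e heS heP hge hae ξ hξ
    rw [mem_glue, hge]
    constructor
    · rintro ⟨-, -, ξ', hξ', h⟩
      have h' := congrArg q h
      rw [hf.snd _ hγ _ (haP.1 hξ), hf.snd _ hγ _ (heP.1 (hd γ hγ e heP hξ'))] at h'
      exact h' ▸ hξ'
    · exact fun h => ⟨hae (hac _ hγa _ hξ), hSD heS, ξ, h, rfl⟩
  ext ξ
  rw [ZFSet.mem_inter]
  have key : ∀ ξ ∈ a, (ξ ∈ d γ a ↔ ξ ∈ d γ b) := by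
    intro ξ hξ
    rw [← mem_iff a haS haP hga (fun _ h => h) ξ hξ, ← mem_iff b hbS hbP hgb hab ξ hξ, heq,
      ZFSet.mem_inter]
    exact and_iff_left (hac _ hγa _ hξ)
  constructor
  · intro h
    have hξ := hd γ hγ a haP h
    exact ⟨(key ξ hξ).1 h, hξ⟩
  · exact fun h => (key ξ h.2).2 h.1

/-! ### The ideal axioms, for any property of lists preserved by gluing -/

theorem isEffableOn_of_disjoint_club {A C : Set ZFSet.{u}} (hC : IsClubIn κ (cardSet lam) C)
    (h : Disjoint A C) (d : ZFSet.{u} → ZFSet.{u}) : IsEffableOn κ lam A d := by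
  intro S hSA hS
  obtain ⟨a, haS, haC⟩ := hS.2 C hC
  exact absurd haC (Set.disjoint_left.1 h (hSA haS))

theorem card_cardSet (lam : Cardinal.{u}) : (cardSet lam).card = lam := by
  rw [cardSet, Ordinal.card_toZFSet, Cardinal.card_ord]

/-- The sets carrying an effable list with the property `T`. -/
def effableIdeal (κ lam : Cardinal.{u}) (T : (ZFSet.{u} → ZFSet.{u}) → Prop) :
    Set (Set ZFSet.{u}) :=
  {A | A ⊆ Pk κ (cardSet lam) ∧ ∃ d, IsList κ lam d ∧ T d ∧ IsEffableOn κ lam A d}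

section effableIdeal

variable {T : (ZFSet.{u} → ZFSet.{u}) → Prop}

theorem mem_effableIdeal_of_disjoint_club (hT : T fun _ => ∅) {A C : Set ZFSet.{u}}
    (hA : A ⊆ Pk κ (cardSet lam)) (hC : IsClubIn κ (cardSet lam) C) (h : Disjoint A C) :
    A ∈ effableIdeal κ lam T :=
  ⟨hA, fun _ => ∅, fun _ _ => ZFSet.empty_subset _, hT, isEffableOn_of_disjoint_club hC h _⟩

theorem mem_effableIdeal_of_subset {A B : Set ZFSet.{u}} (hA : A ∈ effableIdeal κ lam T)
    (h : B ⊆ A) : B ∈ effableIdeal κ lam T := by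
  obtain ⟨hA, d, hd, hT, hE⟩ := hA
  exact ⟨h.trans hA, d, hd, hT, fun S hS => hE S (hS.trans h)⟩

theorem mem_effableIdeal_of_inter_club (hκ : κ.IsRegular) (hκ_unc : ℵ₀ < κ) {A C : Set ZFSet.{u}}
    (hA : A ⊆ Pk κ (cardSet lam)) (hC : IsClubIn κ (cardSet lam) C)
    (h : A ∩ C ∈ effableIdeal κ lam T) : A ∈ effableIdeal κ lam T := by
  obtain ⟨-, d, hd, hT, hE⟩ := h
  refine ⟨hA, d, hd, hT, fun S hS hSt => ?_⟩
  obtain ⟨a, ha, b, hb, h⟩ := hE (S ∩ C) (Set.inter_subset_inter_left C hS)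
    (hSt.inter_club hC hκ hκ_unc)
  exact ⟨a, ha.1, b, hb.1, h⟩

theorem isNormalIdeal_effableIdeal (hκ : κ.IsRegular) (hκ_unc : ℵ₀ < κ) (hκlam : κ ≤ lam)
    (hT : T fun _ => ∅)
    (hglue : ∀ f p q D g d, IsPairing (cardSet lam) f p q → D ⊆ Pk κ (cardSet lam) →
      (∀ a ∈ D, g a ∈ a) → (∀ γ ∈ cardSet lam, IsList κ lam (d γ)) →
      (∀ γ ∈ cardSet lam, T (d γ)) → T (glue f D g d)) :
    IsNormalIdeal κ (cardSet lam) (effableIdeal κ lam T) := by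
  have hempty : ∅ ∈ effableIdeal κ lam T :=
    mem_effableIdeal_of_disjoint_club hT (Set.empty_subset _) (isClubIn_Pk hκ _)
      (Set.empty_disjoint _)
  have hnormal : ∀ D ⊆ Pk κ (cardSet lam), ∀ g : ZFSet.{u} → ZFSet.{u}, (∀ a ∈ D, g a ∈ a) →
      (∀ γ ∈ cardSet lam, {a ∈ D | g a = γ} ∈ effableIdeal κ lam T) →
      D ∈ effableIdeal κ lam T := by
    intro D hD g hg hfib
    obtain ⟨f, p, q, hf⟩ := exists_isPairing (X := cardSet lam)
      (by rw [card_cardSet]; exact hκ_unc.le.trans hκlam)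
    choose! d hd hTd hE using fun γ hγ => (hfib γ hγ).2
    exact ⟨hD, glue f D g d, isList_glue, hglue f p q D g d hf hD hg hd hTd,
      isEffableOn_glue hκ hκ_unc hf hg hd hE⟩
  have hcomplete : ∀ (ι : Type u) (A : ι → Set ZFSet.{u}), #ι < κ →
      (∀ i, A i ∈ effableIdeal κ lam T) → (⋃ i, A i) ∈ effableIdeal κ lam T := by
    intro ι A hι hA
    obtain ⟨e, he, hinj⟩ : ∃ e : ι → ZFSet.{u}, (∀ i, e i ∈ cardSet lam) ∧ e.Injective := by
      have h : #ι ≤ #(Shrink.{u} (cardSet lam)) :=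
        (hι.le.trans hκlam).trans (card_cardSet lam).ge
      obtain ⟨j⟩ := h
      exact ⟨fun i => ((equivShrink (cardSet lam)).symm (j i) : ZFSet),
        fun i => Subtype.property _, fun i i' h => j.injective
          ((equivShrink (cardSet lam)).symm.injective (Subtype.ext h))⟩
    have hR : ZFSet.range e ∈ Pk κ (cardSet lam) := by
      refine ⟨fun z hz => ?_, ?_⟩
      · obtain ⟨i, rfl⟩ := ZFSet.mem_range.1 hz
        exact he i
      · have h := ZFSet.lift_card_range_le.{u, u} (f := e)
        rw [Cardinal.lift_id, Cardinal.lift_id] at h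
        exact h.trans_lt hι
    have hAP : (⋃ i, A i) ⊆ Pk κ (cardSet lam) := Set.iUnion_subset fun i => (hA i).1
    -- On this club every index code `e i` lies in `a`, so sending `a` to the code of some `A i`
    -- containing it is regressive, and normality applies.
    refine mem_effableIdeal_of_inter_club hκ hκ_unc hAP (isClubIn_superset hκ hR) ?_
    have hex : ∀ a ∈ ⋃ i, A i, ∃ γ, ∃ i, a ∈ A i ∧ e i = γ := fun a ha => by
      obtain ⟨i, hi⟩ := Set.mem_iUnion.1 ha
      exact ⟨e i, i, hi, rfl⟩
    choose! g hg using hex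
    refine hnormal _ (fun a ha => hAP ha.1) g (fun a ha => ?_) fun γ _ => ?_
    · obtain ⟨i, -, hi⟩ := hg a ha.1
      exact hi ▸ ha.2.2 (ZFSet.mem_range_self i)
    · by_cases hγ : ∃ i, e i = γ
      · obtain ⟨i, rfl⟩ := hγ
        refine mem_effableIdeal_of_subset (hA i) fun a ha => ?_
        obtain ⟨i', hi', h⟩ := hg a ha.1.1
        exact hinj (h.trans ha.2) ▸ hi'
      · refine mem_effableIdeal_of_subset hempty fun a ha => hγ ?_
        obtain ⟨i, -, h⟩ := hg a ha.1.1
        exact ⟨i, h.trans ha.2⟩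
  refine ⟨fun A hA => hA.1, hempty, fun A hA B => mem_effableIdeal_of_subset hA, ?_, hcomplete,
    fun γ hγ => ?_, hnormal⟩
  · intro A hA B hB
    have h := hcomplete (ULift Bool) (fun i => cond i.down A B)
      ((Cardinal.lt_aleph0_of_finite _).trans hκ_unc) (by rintro ⟨_ | _⟩ <;> assumption)
    refine mem_effableIdeal_of_subset h ?_
    rintro a (ha | ha)
    · exact Set.mem_iUnion.2 ⟨⟨true⟩, ha⟩
    · exact Set.mem_iUnion.2 ⟨⟨false⟩, ha⟩
  · exact mem_effableIdeal_of_disjoint_club hT (fun a ha => ha.1) (isClubIn_mem hκ hγ)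
      (Set.disjoint_left.2 fun a ha ha' => ha.2 ha'.2)

end effableIdeal

/-! ### Thin lists -/

theorem isThin_empty (hκ : κ.IsRegular) : IsThin κ lam fun _ => ∅ := by
  refine ⟨_, isClubIn_Pk hκ _, fun c _ => ?_⟩
  have h : {x : ZFSet.{u} | ∃ a ∈ Pk κ (cardSet lam), c ⊆ a ∧ x = ∅ ∩ c} ⊆ {∅} := by
    rintro _ ⟨a, -, -, rfl⟩
    exact ZFSet.inter_eq_left_of_subset (ZFSet.empty_subset c)
  refine (Cardinal.mk_le_mk_of_subset h).trans_lt ?_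
  rw [Cardinal.mk_singleton]
  exact Cardinal.one_lt_aleph0.trans_le hκ.lift.aleph0_le

/-- For `c` closed under `p` and `q`, a nonempty trace on `c` forces `g a ∈ c` and is determined by
`g a` and `d (g a) a ∩ c`. That leaves fewer than `κ` traces, by regularity. -/
theorem isThin_glue (hκ : κ.IsRegular) (hκ_unc : ℵ₀ < κ) (hf : IsPairing (cardSet lam) f p q)
    (hg : ∀ a ∈ D, g a ∈ a) (hd : ∀ γ ∈ cardSet lam, IsList κ lam (d γ))
    (hthin : ∀ γ ∈ cardSet lam, IsThin κ lam (d γ)) :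
    IsThin κ lam (glue f D g d) := by
  choose! C hC hcard using hthin
  refine ⟨_, ((isClubIn_diagonal hκ hκ_unc hC).inter
    (isClubIn_closed_unary hκ hκ_unc fun x _ => hf.fst_mem x) hκ hκ_unc).inter
    (isClubIn_closed_unary hκ hκ_unc fun x _ => hf.snd_mem x) hκ hκ_unc, ?_⟩
  rintro c ⟨⟨⟨hcP, hcC⟩, -, hp⟩, -, hq⟩
  let R : c → Set ZFSet.{u} := fun γ =>
    (fun y => ZFSet.sep (fun η => ∃ ξ ∈ y, η = f γ ξ) c) ''
      {x | ∃ a ∈ Pk κ (cardSet lam), c ⊆ a ∧ x = d γ a ∩ c}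
  have hsub : {x : ZFSet.{u} | ∃ a ∈ Pk κ (cardSet lam), c ⊆ a ∧ x = glue f D g d a ∩ c} ⊆
      insert ∅ (⋃ γ, R γ) := by
    rintro _ ⟨a, haP, hca, rfl⟩
    rcases ZFSet.eq_empty_or_nonempty (glue f D g d a ∩ c) with h | ⟨η₀, hη₀⟩
    · exact .inl h
    right
    have hcoord : ∀ η ∈ c, ∀ γ ∈ a, ∀ ξ ∈ d γ a, η = f γ ξ → γ ∈ c ∧ ξ ∈ c := by
      rintro _ hη γ hγ ξ hξ rfl
      have hγX := haP.1 hγ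
      have hξX := haP.1 (hd γ hγX a haP hξ)
      exact ⟨hf.fst γ hγX ξ hξX ▸ hp _ hη, hf.snd γ hγX ξ hξX ▸ hq _ hη⟩
    obtain ⟨hη₀, hη₀c⟩ := ZFSet.mem_inter.1 hη₀
    obtain ⟨-, haD, ξ₀, hξ₀, h₀⟩ := mem_glue.1 hη₀
    have hγa := hg a haD
    refine Set.mem_iUnion.2 ⟨⟨g a, (hcoord η₀ hη₀c _ hγa ξ₀ hξ₀ h₀).1⟩,
      d (g a) a ∩ c, ⟨a, haP, hca, rfl⟩, ?_⟩
    ext η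
    simp only [ZFSet.mem_sep, ZFSet.mem_inter, mem_glue]
    constructor
    · rintro ⟨hη, ξ, hξ, h⟩
      exact ⟨⟨hca hη, haD, ξ, hξ.1, h⟩, hη⟩
    · rintro ⟨⟨-, -, ξ, hξ, h⟩, hη⟩
      exact ⟨hη, ξ, ⟨hξ, (hcoord η hη _ hγa ξ hξ h).2⟩, h⟩
  have hR : ∀ γ, #(R γ) < Cardinal.lift.{u + 1} κ := fun γ =>
    Cardinal.mk_image_le.trans_lt (hcard γ (hcP.1 γ.2) c (hcC γ γ.2))
  have hU : #(⋃ γ, R γ) < Cardinal.lift.{u + 1} κ := by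
    refine (Cardinal.card_iUnion_lt_iff_forall_of_isRegular hκ.lift ?_).2 hR
    rw [ZFSet.cardinalMk_coe_sort, Cardinal.lift_lt]
    exact hcP.2
  refine (Cardinal.mk_le_mk_of_subset hsub).trans_lt (Cardinal.mk_insert_le.trans_lt ?_)
  exact Cardinal.add_lt_of_lt hκ.lift.aleph0_le hU
    (Cardinal.one_lt_aleph0.trans_le hκ.lift.aleph0_le)

/-! ### Slender lists -/

theorem mem_H_of_subset_cardSet {θ : Cardinal.{u}} (hθ : lam < θ) {x : ZFSet.{u}}
    (hx : x ⊆ cardSet lam) : x ∈ H θ :=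
  mem_H.2 ⟨cardSet lam, (ZFSet.isOrdinal_toZFSet _).isTransitive, hx, by rwa [card_cardSet]⟩

theorem mem_H_of_mem_cardSet {θ : Cardinal.{u}} (hθ : lam < θ) {x : ZFSet.{u}}
    (hx : x ∈ cardSet lam) : x ∈ H θ :=
  mem_H_of_subset_cardSet hθ ((ZFSet.isOrdinal_toZFSet _).subset_of_mem hx)

theorem isSlender_empty (hκ : κ.IsRegular) : IsSlender κ lam fun _ => ∅ := by
  refine ⟨Order.succ lam, fun θ hθ => ⟨_, isClubIn_mem hκ (mem_H_of_subset_cardSet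
    (Order.succ_le_iff.1 hθ) (ZFSet.empty_subset _)), fun M hM b _ _ => ?_⟩⟩
  rw [ZFSet.inter_eq_left_of_subset (ZFSet.empty_subset b)]
  exact hM.2

/-- With `a = M ∩ lam` in `D` and `γ = g a`, pull `b` back along `f γ`, apply slenderness of `d γ`,
and push the result forward; `M` is closed under both operations. -/
theorem isSlender_glue (hκ : κ.IsRegular) (hκ_unc : ℵ₀ < κ) (hf : IsPairing (cardSet lam) f p q)
    (hD : D ⊆ Pk κ (cardSet lam)) (hg : ∀ a ∈ D, g a ∈ a)
    (hd : ∀ γ ∈ cardSet lam, IsList κ lam (d γ))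
    (hsl : ∀ γ ∈ cardSet lam, IsSlender κ lam (d γ)) : IsSlender κ lam (glue f D g d) := by
  classical
  choose! θ₀ C hC hmem using hsl
  refine ⟨max (Order.succ lam) (⨆ γ : cardSet lam, θ₀ γ), fun θ hθ => ?_⟩
  have hlam : lam < θ := Order.succ_le_iff.1 ((le_max_left _ _).trans hθ)
  have hθ₀ : ∀ γ ∈ cardSet lam, θ₀ γ ≤ θ := fun γ hγ =>
    (le_ciSup (f := fun γ : cardSet lam => θ₀ γ) Cardinal.bddAbove_of_small ⟨γ, hγ⟩).trans
      ((le_max_right _ _).trans hθ)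
  let pre : ZFSet.{u} → ZFSet.{u} → ZFSet.{u} := fun γ b =>
    ZFSet.sep (fun ξ => f γ ξ ∈ b) (cardSet lam)
  let img : ZFSet.{u} → ZFSet.{u} → ZFSet.{u} := fun γ y =>
    ZFSet.sep (fun η => ∃ ξ ∈ y, η = f γ ξ) (cardSet lam)
  -- The diagonal runs over all of `H θ`, so elements outside `lam` get the trivial club.
  have hdiag := isClubIn_diagonal hκ hκ_unc (X := H θ)
    (C := fun γ => if γ ∈ cardSet lam then C γ θ else Pk κ (H θ)) fun γ _ => by
      by_cases hγ : γ ∈ cardSet lam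
      · simpa only [if_pos hγ] using hC γ hγ θ (hθ₀ γ hγ)
      · simpa only [if_neg hγ] using isClubIn_Pk hκ _
  have hop : ∀ F : ZFSet.{u} → ZFSet.{u} → ZFSet.{u}, (∀ x y, F x y ⊆ cardSet lam) →
      IsClubIn κ (H θ) {a ∈ Pk κ (H θ) | ∀ x ∈ a, ∀ y ∈ a, F x y ∈ a} := fun F hF =>
    isClubIn_closed_binary hκ hκ_unc fun x _ y _ => mem_H_of_subset_cardSet hlam (hF x y)
  refine ⟨_, (((hdiag.inter (hop pre fun _ _ => ZFSet.sep_subset) hκ hκ_unc).inter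
    (hop img fun _ _ => ZFSet.sep_subset) hκ hκ_unc).inter
    (isClubIn_closed_binary hκ hκ_unc fun x _ y _ => mem_H_of_mem_cardSet hlam (hf.mem x y))
    hκ hκ_unc).inter
    (isClubIn_mem hκ (mem_H_of_subset_cardSet hlam (ZFSet.empty_subset _))) hκ hκ_unc, ?_⟩
  rintro M ⟨⟨⟨⟨⟨-, hMC⟩, -, hpre⟩, -, himg⟩, -, hMf⟩, -, hM₀⟩ b hbM hb
  set a := M ∩ cardSet lam
  by_cases haD : a ∈ D
  · obtain ⟨hγM, hγ⟩ := ZFSet.mem_inter.1 (hg a haD)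
    -- `f (g a)` is injective on `lam`, so the preimage of the countable `b` is countable.
    have hpreP : pre (g a) b ∈ Pk ℵ₁ (cardSet lam) := by
      refine ⟨ZFSet.sep_subset, lt_of_le_of_lt ?_ hb.2⟩
      rw [← Cardinal.lift_le.{u + 1}, ← ZFSet.cardinalMk_coe_sort, ← ZFSet.cardinalMk_coe_sort]
      refine Cardinal.mk_le_of_injective
        (f := fun ξ : pre (g a) b => (⟨f (g a) ξ, (ZFSet.mem_sep.1 ξ.2).2⟩ : b)) fun ξ ξ' h => ?_
      have h' := congrArg q (congrArg Subtype.val h)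
      simp only [hf.snd _ hγ _ (ZFSet.mem_sep.1 ξ.2).1,
        hf.snd _ hγ _ (ZFSet.mem_sep.1 ξ'.2).1] at h'
      exact Subtype.ext h'
    have hMγ : M ∈ C (g a) θ := by simpa only [if_pos hγ] using hMC _ hγM
    have h1 := hmem _ hγ θ (hθ₀ _ hγ) M hMγ _ (hpre _ hγM _ hbM) hpreP
    have h2 : glue f D g d a ∩ b = img (g a) (d (g a) a ∩ pre (g a) b) := by
      ext η
      simp only [img, pre, ZFSet.mem_sep, ZFSet.mem_inter, mem_glue]
      constructor
      · rintro ⟨⟨hη, -, ξ, hξ, rfl⟩, hηb⟩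
        exact ⟨hf.mem _ _, ξ, ⟨hξ, (hD haD).1 (hd _ hγ a (hD haD) hξ), hηb⟩, rfl⟩
      · rintro ⟨hη, ξ, ⟨hξ, hξX, hξb⟩, rfl⟩
        have hξM := (ZFSet.mem_inter.1 (hd _ hγ a (hD haD) hξ)).1
        exact ⟨⟨ZFSet.mem_inter.2 ⟨hMf _ hγM _ hξM, hη⟩, haD, ξ, hξ, rfl⟩, hξb⟩
    rw [h2]
    exact himg _ hγM _ h1
  · have h : glue f D g d a ∩ b = ∅ := by
      rw [ZFSet.eq_empty]
      intro η hη
      exact haD (mem_glue.1 (ZFSet.mem_inter.1 hη).1).2.1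
    exact h ▸ hM₀

end TwoCardinal

theorem mainTheorem6 (κ lam : Cardinal.{u}) (hκ : κ.IsRegular) (hκ_unc : ℵ₀ < κ)
    (hκlam : κ ≤ lam) :
    TwoCardinal.IsNormalIdeal κ (TwoCardinal.cardSet lam) (TwoCardinal.I_IT κ lam) ∧
      TwoCardinal.IsNormalIdeal κ (TwoCardinal.cardSet lam) (TwoCardinal.I_IS κ lam) :=
  ⟨TwoCardinal.isNormalIdeal_effableIdeal hκ hκ_unc hκlam (TwoCardinal.isThin_empty hκ)
      fun _ _ _ _ _ _ hf _ hg hd hT => TwoCardinal.isThin_glue hκ hκ_unc hf hg hd hT,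
    TwoCardinal.isNormalIdeal_effableIdeal hκ hκ_unc hκlam (TwoCardinal.isSlender_empty hκ)
      fun _ _ _ _ _ _ hf hD hg hd hT => TwoCardinal.isSlender_glue hκ hκ_unc hf hD hg hd hT⟩
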